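/- Let $\ell$ be a line in the Euclidean plane. For a positive integer $n$ let $g(n)$ denote the largest possible number of unit-area triangles formed by $\ell$ and two elements of $\mathcal{L}$, where $\mathcal{L}$ ranges over all sets of $n$ lines different from $\ell$. (Three lines form a triangle if they are pairwise non-parallel and do not pass through a common point.) Then $g(n)=\Theta(n^{4/3})$; that is, there are absolute constants $c,C>0$ and $N$, independent of $\ell$, such that $c\,n^{4/3}\le g(n)\le C\,n^{4/3}$ for all $n\ge N$. -/

import Mathlib

open MeasureTheory

noncomputable section

namespace UnitAreaTriangles

/-- The Euclidean plane. -/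
abbrev Plane : Type := EuclideanSpace ℝ (Fin 2)

/-- A line of the plane: a one-dimensional affine subspace. -/
def IsLine (a : AffineSubspace ℝ Plane) : Prop :=
  Module.finrank ℝ a.direction = 1

/-- The nondegenerate triangle `T` is formed by the lines `a`, `b`, `c`: these are the lines
supporting its three sides. (No triangle is formed by lines two of which are equal or parallel, or
by three concurrent lines, since the vertices of `T` are affinely independent.) -/
def IsFormedBy (T : Affine.Triangle ℝ Plane) (a b c : AffineSubspace ℝ Plane) : Prop :=
  a = line[ℝ, T.points 0, T.points 1] ∧
  b = line[ℝ, T.points 0, T.points 2] ∧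
  c = line[ℝ, T.points 1, T.points 2]

/-- The lines `a`, `b`, `c` form a triangle of unit area (two-dimensional Lebesgue measure of the
filled triangle). -/
def FormUnitTriangle (a b c : AffineSubspace ℝ Plane) : Prop :=
  ∃ T : Affine.Triangle ℝ Plane,
    IsFormedBy T a b c ∧ volume (convexHull ℝ (Set.range T.points)) = 1

open Classical in
/-- The number of unit-area triangles formed by `ℓ` and two elements of `L`, each triangle being
counted as the unordered pair of lines of `L` that support its other two sides. -/
def unitTriangleCount (ℓ : AffineSubspace ℝ Plane) (L : Finset (AffineSubspace ℝ Plane)) : ℕ :=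
  ((L.powersetCard 2).filter
    (fun s => ∃ a b, s = {a, b} ∧ FormUnitTriangle ℓ a b)).card

/-- The numbers of unit-area triangles with a side on `ℓ` that occur for a set of `n` further
lines. -/
def unitTriangleCounts (ℓ : AffineSubspace ℝ Plane) (n : ℕ) : Set ℕ :=
  {k | ∃ L : Finset (AffineSubspace ℝ Plane),
    (∀ a ∈ L, IsLine a) ∧ ℓ ∉ L ∧ L.card = n ∧ unitTriangleCount ℓ L = k}

/-- The largest possible number of unit-area triangles formed by `ℓ` and two of `n` further
lines. -/
def g (ℓ : AffineSubspace ℝ Plane) (n : ℕ) : ℕ :=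
  sSup (unitTriangleCounts ℓ n)

theorem infinite_setOf_isLine : {a : AffineSubspace ℝ Plane | IsLine a}.Infinite := by
  let f : ℝ → AffineSubspace ℝ Plane := fun t =>
    AffineSubspace.mk' (!₂[0, t] : Plane) (Submodule.span ℝ {(!₂[1, 0] : Plane)})
  have hf : Function.Injective f := by
    intro s t h
    have hs : (!₂[0, s] : Plane) ∈ f t := h ▸ AffineSubspace.self_mem_mk' _ _
    rw [AffineSubspace.mem_mk', Submodule.mem_span_singleton] at hs
    obtain ⟨r, hr⟩ := hs
    have h1 := congrArg (fun v : Plane => v 1) hr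
    simp at h1
    linarith
  refine (Set.infinite_range_of_injective hf).mono ?_
  rintro _ ⟨t, rfl⟩
  change Module.finrank ℝ (AffineSubspace.direction (AffineSubspace.mk' _ _)) = 1
  rw [AffineSubspace.direction_mk']
  refine finrank_span_singleton fun h => ?_
  have h0 := congrArg (fun v : Plane => v 0) h
  simp at h0

/-- `g ℓ n` is a maximum. -/
theorem isGreatest_g (ℓ : AffineSubspace ℝ Plane) (n : ℕ) :
    IsGreatest (unitTriangleCounts ℓ n) (g ℓ n) := by
  have hb : BddAbove (unitTriangleCounts ℓ n) := by
    classical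
    refine ⟨n.choose 2, ?_⟩
    rintro k ⟨L, -, -, hn, rfl⟩
    rw [← hn, ← Finset.card_powersetCard, unitTriangleCount]
    exact Finset.card_le_card (Finset.filter_subset _ _)
  have hne : (unitTriangleCounts ℓ n).Nonempty := by
    obtain ⟨L, hL, hn⟩ :=
      (infinite_setOf_isLine.sdiff (Set.finite_singleton ℓ)).exists_subset_card_eq n
    exact ⟨_, L, fun a ha => (hL ha).1, fun h => (hL h).2 rfl, hn, rfl⟩
  exact ⟨Nat.sSup_mem hne hb, fun k hk => le_csSup hb hk⟩

end UnitAreaTriangles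

end

open MeasureTheory

noncomputable section

/-! Choose orthonormal coordinates in which `ℓ` is the axis `Y = 0`. Every line not parallel to `ℓ`
is `X = a + m Y` for a unique pair `(a, m)`, and two such lines with `a ≠ a'` and `m ≠ m'` cut off
with `ℓ` a triangle of area `(a - a')² / (2|m - m'|)`. Unit area with `m ≥ m'` thus reads `m - a²/2
= -a' a + (m' + a'²/2)`: a point determined by the first line lies on a line determined by the
second (`Frame.formUnitTriangle_iff`). Counting unit triangles becomes counting incidences.

The upper bound is then Szemerédi–Trotter (`card_incidences_le`), proved by Székely's method. A
plane straight-line graph has at most `3|V|` edges, random sampling of vertices turns this into a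
crossing inequality, and that is applied to the segments between consecutive points on each line.
The lower bound (`pow_four_le_g`) pulls back the standard grid configuration with about `n^{4/3}`
incidences. -/

/-- A family of non-vertical segments in the plane, each given by its left and right endpoint and by
the slope and intercept of its supporting line. -/
structure SegmentFamily (ι : Type*) where
  left : ι → ℝ × ℝ
  right : ι → ℝ × ℝ
  slope : ι → ℝ
  icpt : ι → ℝ
  left_lt_right : ∀ i, (left i).1 < (right i).1
  left_on : ∀ i, (left i).2 = slope i * (left i).1 + icpt i
  right_on : ∀ i, (right i).2 = slope i * (right i).1 + icpt i

/-! ### Plane straight-line graphs: edges, vertices and crossings -/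

namespace SegmentFamily

variable {ι : Type*} (S : SegmentFamily ι)

/-- The height over `x` of the line supporting a segment. -/
def height (i : ι) (x : ℝ) : ℝ := S.slope i * x + S.icpt i

/-- The relative interior of the segment has a point over `x`. -/
def Over (i : ι) (x : ℝ) : Prop := (S.left i).1 < x ∧ x < (S.right i).1

/-- The relative interiors of two segments meet. -/
def Crosses (i j : ι) : Prop := ∃ x, S.Over i x ∧ S.Over j x ∧ S.height i x = S.height j x

/-- No point of `V` lies in the relative interior of a segment. -/
def Avoids (V : Finset (ℝ × ℝ)) : Prop := ∀ i, ∀ w ∈ V, S.Over i w.1 → w.2 ≠ S.height i w.1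

variable {S}

theorem height_le_of_not_crosses {i j : ι} (h : ¬ S.Crosses i j) {x y : ℝ} (hxy : x < y)
    (hix : (S.left i).1 ≤ x) (hjx : (S.left j).1 ≤ x)
    (hiy : y ≤ (S.right i).1) (hjy : y ≤ (S.right j).1)
    (hlt : S.height i x < S.height j x) : S.height i y ≤ S.height j y := by
  by_contra! hgt
  apply h
  set A := S.height j x - S.height i x with hA
  set B := S.height i y - S.height j y with hB
  have hA0 : 0 < A := by linarith
  have hB0 : 0 < B := by linarith
  have hAB : 0 < A + B := by linarith
  -- The difference of heights is affine, `A` at `x` and `-B` at `y`; this point is its zero.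
  have h1 : x < x + (y - x) * (A / (A + B)) := by
    have : 0 < (y - x) * (A / (A + B)) := mul_pos (by linarith) (by positivity)
    linarith
  have h2 : x + (y - x) * (A / (A + B)) < y := by
    have h3 : A / (A + B) < 1 := (div_lt_one hAB).2 (by linarith)
    nlinarith
  refine ⟨x + (y - x) * (A / (A + B)), ⟨by linarith, by linarith⟩, ⟨by linarith, by linarith⟩, ?_⟩
  have h4 : A + B = (S.slope i - S.slope j) * (y - x) := by
    simp only [hA, hB, height]; ring
  have h5 : (S.slope i - S.slope j) * ((y - x) * (A / (A + B))) = A := by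
    rw [← mul_assoc, ← h4]; field_simp
  have h6 : A = S.slope j * x + S.icpt j - (S.slope i * x + S.icpt i) := rfl
  simp only [height]
  linear_combination h5 + h6

/-- A segment that is neither the steepest one at its left endpoint nor the least steep one at its
right endpoint is the first one below some vertex. -/
theorem exists_first_below {V : Finset (ℝ × ℝ)} {E : Finset ι} (hl : ∀ i ∈ E, S.left i ∈ V)
    (hr : ∀ i ∈ E, S.right i ∈ V) (hV : S.Avoids V)
    (hE : ∀ i ∈ E, ∀ j ∈ E, i ≠ j → ¬ S.Crosses i j) {e : ι} (he : e ∈ E)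
    (hu : ∃ g ∈ E, S.left g = S.left e ∧ S.slope e < S.slope g)
    (hv : ∃ f ∈ E, S.right f = S.right e ∧ S.slope f < S.slope e) :
    ∃ w ∈ V, S.Over e w.1 ∧ S.height e w.1 < w.2 ∧
      ∀ g ∈ E, S.Over g w.1 → S.height g w.1 < w.2 → S.height g w.1 ≤ S.height e w.1 := by
  classical
  -- `e'` is the next edge above `e` at their common left endpoint. The vertex sought is a leftmost
  -- one in the wedge between `e` and `e'`.
  obtain ⟨e', he', hmin⟩ := Finset.exists_min_image
    (E.filter fun g => S.left g = S.left e ∧ S.slope e < S.slope g) S.slope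
    (by obtain ⟨g, hg, h⟩ := hu; exact ⟨g, by simp [hg, h]⟩)
  simp only [Finset.mem_filter] at he' hmin
  obtain ⟨he'E, hle', hse'⟩ := he'
  obtain ⟨f, hf, hrf, hsf⟩ := hv
  have eL := S.left_on e
  have eR := S.right_on e
  have e'L := S.left_on e'
  have e'R := S.right_on e'
  have fR := S.right_on f
  have fL := S.left_on f
  have elt := S.left_lt_right e
  have e'lt := S.left_lt_right e'
  have flt := S.left_lt_right f
  rw [hle'] at e'L e'lt
  rw [hrf] at fR flt
  have e_e' : ∀ x, (S.left e).1 < x → S.height e x < S.height e' x := by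
    intro x hx
    simp only [height]
    nlinarith
  have e_f : ∀ x, x < (S.right e).1 → S.height e x < S.height f x := by
    intro x hx
    simp only [height]
    nlinarith
  have hfe' : f ≠ e' := by rintro rfl; linarith
  have hfe : S.height f (S.right e).1 < S.height e' (S.right e).1 := by
    have := e_e' _ elt
    simp only [height] at this ⊢
    linarith
  obtain ⟨w, hw, hwmin⟩ := Finset.exists_min_image
    (V.filter fun w => S.Over e w.1 ∧ w.1 ≤ (S.right e').1 ∧ S.height e w.1 < w.2 ∧
      w.2 ≤ S.height e' w.1) Prod.fst (by
    -- The wedge contains a vertex: the right end of `e'` if it comes before that of `e`. Otherwise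
    -- `f`, which arrives at the right end of `e` from above and cannot cross `e'`, has to start
    -- inside the wedge.
    rcases lt_or_ge (S.right e').1 (S.right e).1 with h | h
    · refine ⟨S.right e', ?_⟩
      simp only [Finset.mem_filter]
      refine ⟨hr _ he'E, ⟨e'lt, h⟩, le_rfl, ?_, e'R.le⟩
      rw [e'R]
      exact e_e' _ e'lt
    · have key : ∀ x, (S.left f).1 ≤ x → (S.left e).1 ≤ x → x < (S.right e).1 →
          S.height f x ≤ S.height e' x := by
        intro x h1 h2 h3
        by_contra! h4
        have := height_le_of_not_crosses (hE e' he'E f hf hfe'.symm) h3 (hle' ▸ h2) h1 h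
          (by rw [hrf]) h4
        linarith
      rcases le_or_gt (S.left f).1 (S.left e).1 with h1 | h1
      · exfalso
        have h2 := key _ h1 le_rfl elt
        have h3 := e_f _ elt
        simp only [height] at h2 h3
        linarith
      · refine ⟨S.left f, ?_⟩
        simp only [Finset.mem_filter]
        refine ⟨hl _ hf, ⟨h1, flt⟩, by linarith, ?_, ?_⟩
        · rw [fL]; exact e_f _ flt
        · exact fL.le.trans (key _ le_rfl h1.le flt))
  simp only [Finset.mem_filter] at hw hwmin
  obtain ⟨hwV, hwe, hwe', hew, hew'⟩ := hw
  refine ⟨w, hwV, hwe, hew, fun g hg hgw hlt => ?_⟩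
  by_contra! hgt
  have hge : g ≠ e := by rintro rfl; exact lt_irrefl _ hgt
  have hge' : g ≠ e' := by rintro rfl; linarith
  have gL := S.left_on g
  have below : ∀ x, (S.left g).1 ≤ x → (S.left e).1 ≤ x → x < w.1 →
      S.height g x ≤ S.height e' x := by
    intro x h1 h2 h3
    by_contra! h4
    have := height_le_of_not_crosses (hE e' he'E g hg hge'.symm) h3 (hle' ▸ h2) h1 hwe' hgw.2.le h4
    linarith
  have above : ∀ x, (S.left g).1 ≤ x → (S.left e).1 ≤ x → x < w.1 →
      S.height e x ≤ S.height g x := by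
    intro x h1 h2 h3
    by_contra! h4
    have := height_le_of_not_crosses (hE g hg e he hge) h3 h1 h2 hgw.2.le hwe.2.le h4
    linarith
  -- An edge `g` strictly between `e` and `w` is trapped in the wedge to the left of `w`. It cannot
  -- pass through the apex (`hV`), nor start there (`e'` has the next slope), nor start inside the
  -- wedge (`w` is leftmost).
  rcases le_or_gt (S.left g).1 (S.left e).1 with h1 | h1
  · have h2 := below _ h1 le_rfl hwe.1
    have h3 := above _ h1 le_rfl hwe.1
    have h4 : (S.left e).2 = S.height g (S.left e).1 := by
      simp only [height] at h2 h3 ⊢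
      linarith
    rcases h1.lt_or_eq with h5 | h5
    · exact hV g _ (hl _ he) ⟨h5, hwe.1.trans hgw.2⟩ h4
    · have h6 : S.left g = S.left e := Prod.ext h5 (by rw [gL, h4, h5]; rfl)
      rw [h6] at gL
      have h7 : S.slope e < S.slope g := by
        have := hwe.1
        simp only [height] at hgt
        nlinarith
      have h8 := hmin g ⟨hg, h6, h7⟩
      have := hwe.1
      simp only [height] at hlt hew'
      nlinarith
  · have h2 := below _ le_rfl h1.le hgw.1
    have h3 := above _ le_rfl h1.le hgw.1
    have h4 : S.Over e (S.left g).1 := ⟨h1, hgw.1.trans hwe.2⟩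
    have h5 : (S.left g).2 = S.height g (S.left g).1 := gL
    have h6 := hV e _ (hl _ hg) h4
    have := hwmin (S.left g) ⟨hl _ hg, h4, by linarith [hgw.1],
      lt_of_le_of_ne (by rw [h5]; exact h3) h6.symm, by rw [h5]; exact h2⟩
    linarith [hgw.1]

theorem crosses_of_left_eq {i j : ι} (hl : S.left i = S.left j) (hs : S.slope i = S.slope j) :
    S.Crosses i j := by
  have h1 := S.left_on i
  have h2 := S.left_on j
  have h3 := S.left_lt_right i
  have h4 := S.left_lt_right j
  obtain ⟨x, hx, hx'⟩ := exists_between (lt_min (hl ▸ h3) h4)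
  refine ⟨x, ⟨hl ▸ hx, hx'.trans_le (min_le_left _ _)⟩, ⟨hx, hx'.trans_le (min_le_right _ _)⟩, ?_⟩
  rw [hl, hs] at h1
  simp only [height, hs]
  linarith

theorem crosses_of_right_eq {i j : ι} (hr : S.right i = S.right j) (hs : S.slope i = S.slope j) :
    S.Crosses i j := by
  have h1 := S.right_on i
  have h2 := S.right_on j
  have h3 := S.left_lt_right i
  have h4 := S.left_lt_right j
  obtain ⟨x, hx, hx'⟩ := exists_between (max_lt (hr ▸ h3) h4)
  refine ⟨x, ⟨(le_max_left _ _).trans_lt hx, hr ▸ hx'⟩, ⟨(le_max_right _ _).trans_lt hx, hx'⟩, ?_⟩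
  rw [hr, hs] at h1
  simp only [height, hs]
  linarith

/-- A plane straight-line graph has at most three times as many edges as vertices. -/
theorem card_le_of_not_crosses {V : Finset (ℝ × ℝ)} {E : Finset ι} (hl : ∀ i ∈ E, S.left i ∈ V)
    (hr : ∀ i ∈ E, S.right i ∈ V) (hV : S.Avoids V)
    (hE : ∀ i ∈ E, ∀ j ∈ E, i ≠ j → ¬ S.Crosses i j) : E.card ≤ 3 * V.card := by
  classical
  let A := E.filter fun e => ∀ g ∈ E, S.left g = S.left e → S.slope g ≤ S.slope e
  let B := E.filter fun e => ∀ g ∈ E, S.right g = S.right e → S.slope e ≤ S.slope g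
  let C := E.filter fun e => ∃ w ∈ V, S.Over e w.1 ∧ S.height e w.1 < w.2 ∧
      ∀ g ∈ E, S.Over g w.1 → S.height g w.1 < w.2 → S.height g w.1 ≤ S.height e w.1
  -- Each edge is charged to its left endpoint, its right endpoint, or the vertex it is first below.
  -- Two edges charged alike to one vertex would cross, so each class has at most `V.card` members.
  have hcover : E ⊆ A ∪ B ∪ C := by
    intro e he
    simp only [A, B, C, Finset.mem_union, Finset.mem_filter, he, true_and]
    by_contra! h
    obtain ⟨⟨⟨g, hg⟩, ⟨f, hf⟩⟩, h⟩ := h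
    obtain ⟨w, hw, h1, h2, h3⟩ := exists_first_below hl hr hV hE he ⟨g, hg⟩ ⟨f, hf⟩
    obtain ⟨g, hg, h4, h5, h6⟩ := h w hw h1 h2
    exact absurd (h3 g hg h4 h5) (not_le.2 h6)
  have hA : A.card ≤ V.card := by
    refine Finset.card_le_card_of_injOn S.left (fun e he => hl e (Finset.mem_filter.1 he).1) ?_
    intro i hi j hj hij
    obtain ⟨hi, hi'⟩ := Finset.mem_filter.1 hi
    obtain ⟨hj, hj'⟩ := Finset.mem_filter.1 hj
    by_contra hne
    exact hE i hi j hj hne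
      (crosses_of_left_eq hij (le_antisymm (hj' i hi hij) (hi' j hj hij.symm)))
  have hB : B.card ≤ V.card := by
    refine Finset.card_le_card_of_injOn S.right (fun e he => hr e (Finset.mem_filter.1 he).1) ?_
    intro i hi j hj hij
    obtain ⟨hi, hi'⟩ := Finset.mem_filter.1 hi
    obtain ⟨hj, hj'⟩ := Finset.mem_filter.1 hj
    by_contra hne
    exact hE i hi j hj hne
      (crosses_of_right_eq hij (le_antisymm (hi' j hj hij.symm) (hj' i hi hij)))
  have hC : C.card ≤ V.card := by
    have hex : ∀ e, ∃ w, e ∈ C → w ∈ V ∧ S.Over e w.1 ∧ S.height e w.1 < w.2 ∧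
        ∀ g ∈ E, S.Over g w.1 → S.height g w.1 < w.2 → S.height g w.1 ≤ S.height e w.1 := by
      intro e
      by_cases he : e ∈ C
      · obtain ⟨w, hw⟩ := (Finset.mem_filter.1 he).2
        exact ⟨w, fun _ => hw⟩
      · exact ⟨0, fun h => absurd h he⟩
    choose w hw using hex
    refine Finset.card_le_card_of_injOn w (fun e he => (hw e he).1) ?_
    intro i hi j hj hij
    obtain ⟨-, hi1, hi2, hi3⟩ := hw i hi
    obtain ⟨-, hj1, hj2, hj3⟩ := hw j hj
    rw [← hij] at hj1 hj2 hj3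
    have hi := (Finset.mem_filter.1 hi).1
    have hj := (Finset.mem_filter.1 hj).1
    by_contra hne
    exact hE i hi j hj hne
      ⟨_, hi1, hj1, le_antisymm (hj3 i hi hi1 hi2) (hi3 j hj hj1 hj2)⟩
  have := Finset.card_le_card hcover
  have := Finset.card_union_le (A ∪ B) C
  have := Finset.card_union_le A B
  omega

open Classical in
/-- The ordered pairs of distinct crossing segments. -/
def crossings (S : SegmentFamily ι) (E : Finset ι) : Finset (ι × ι) :=
  (E ×ˢ E).filter fun p => p.1 ≠ p.2 ∧ S.Crosses p.1 p.2

/-- Deleting the first edge of every crossing pair leaves a plane graph. -/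
theorem card_le_add_crossings {V : Finset (ℝ × ℝ)} {E : Finset ι} (hl : ∀ i ∈ E, S.left i ∈ V)
    (hr : ∀ i ∈ E, S.right i ∈ V) (hV : S.Avoids V) :
    E.card ≤ 3 * V.card + (S.crossings E).card := by
  classical
  have h := card_le_of_not_crosses (S := S) (V := V) (E := E \ (S.crossings E).image Prod.fst)
    (fun i hi => hl i (Finset.mem_sdiff.1 hi).1) (fun i hi => hr i (Finset.mem_sdiff.1 hi).1) hV
    (by
      intro i hi j hj hij hc
      rw [Finset.mem_sdiff] at hi hj
      refine hi.2 (Finset.mem_image.2 ⟨(i, j), ?_, rfl⟩)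
      simp [crossings, hi.1, hj.1, hij, hc])
  have h1 := Finset.le_card_sdiff ((S.crossings E).image Prod.fst) E
  have h2 : ((S.crossings E).image Prod.fst).card ≤ _ := Finset.card_image_le
  omega

end SegmentFamily

/-! ### Random sampling of vertices and the crossing inequality -/

/-- A uniform `f : α → Fin m` encodes a random subset, the zero set of `f`; it contains `T` with
probability `m ^ (-|T|)`, here with denominators cleared. -/
theorem card_filter_forall_eq_zero {α : Type*} [Fintype α] [DecidableEq α] (m : ℕ) [NeZero m]
    (T : Finset α) :
    (Finset.univ.filter fun f : α → Fin m => ∀ v ∈ T, f v = 0).card * m ^ T.card =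
      m ^ Fintype.card α := by
  have h : (Finset.univ.filter fun f : α → Fin m => ∀ v ∈ T, f v = 0) =
      Fintype.piFinset fun v => if v ∈ T then {0} else Finset.univ := by
    ext f
    simp only [Finset.mem_filter, Finset.mem_univ, true_and, Fintype.mem_piFinset]
    refine forall_congr' fun v => ?_
    split_ifs with hv <;> simp [hv]
  have h2 : ∀ v, (if v ∈ T then ({0} : Finset (Fin m)) else Finset.univ).card =
      if v ∈ T then 1 else m := by
    intro v; split_ifs <;> simp
  rw [h, Fintype.card_piFinset, Finset.prod_congr rfl fun v _ => h2 v, Finset.prod_ite]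
  simp only [Finset.prod_const_one, one_mul, Finset.prod_const]
  rw [← pow_add]
  congr 1
  have := Finset.card_filter_add_card_filter_not (s := (Finset.univ : Finset α)) (fun v => v ∈ T)
  simp only [Finset.filter_univ_mem, Finset.card_univ] at this
  omega

theorem sum_card_filter_forall_eq_zero {α β : Type*} [Fintype α] [DecidableEq α] (m : ℕ) [NeZero m]
    (E : Finset β) (T : β → Finset α) (k : ℕ) (hT : ∀ e ∈ E, (T e).card = k) :
    (∑ f : α → Fin m, (E.filter fun e => ∀ v ∈ T e, f v = 0).card) * m ^ k =
      E.card * m ^ Fintype.card α := by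
  have h := Finset.sum_card_bipartiteAbove_eq_sum_card_bipartiteBelow
    (s := (Finset.univ : Finset (α → Fin m))) (t := E) fun f e => ∀ v ∈ T e, f v = 0
  simp only [Finset.bipartiteAbove, Finset.bipartiteBelow] at h
  rw [h, Finset.sum_mul, Finset.sum_congr rfl fun e he => by
    rw [← hT e he, card_filter_forall_eq_zero], Finset.sum_const, smul_eq_mul]

namespace SegmentFamily

variable {ι : Type*} {S : SegmentFamily ι}

theorem crosses_of_mem_crossings {E : Finset ι} {p : ι × ι} (h : p ∈ S.crossings E) :
    p.1 ≠ p.2 ∧ S.Crosses p.1 p.2 := by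
  classical
  simp only [crossings, Finset.mem_filter] at h
  exact h.2

/-- A crossing inequality: average `card_le_add_crossings` over random sets of vertices, each vertex
being kept with probability `1 / m`. -/
theorem sq_mul_card_le {V : Finset (ℝ × ℝ)} {E : Finset ι} (hl : ∀ i, S.left i ∈ V)
    (hr : ∀ i, S.right i ∈ V) (hV : S.Avoids V)
    (hd : ∀ i j, i ≠ j → S.Crosses i j → S.left i ≠ S.left j ∧ S.left i ≠ S.right j ∧
      S.right i ≠ S.left j ∧ S.right i ≠ S.right j) (m : ℕ) (hm : m ≠ 0) :
    m ^ 2 * E.card ≤ 3 * m ^ 3 * V.card + (S.crossings E).card := by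
  classical
  have : NeZero m := ⟨hm⟩
  let L : ι → V := fun i => ⟨S.left i, hl i⟩
  let R : ι → V := fun i => ⟨S.right i, hr i⟩
  have hLR : ∀ i, L i ≠ R i := fun i h => by
    have h1 := congrArg (fun v : V => v.1.1) h
    exact (S.left_lt_right i).ne h1
  have hE := sum_card_filter_forall_eq_zero m E (fun i => ({L i, R i} : Finset V)) 2
    fun i _ => Finset.card_pair (hLR i)
  have hVs := sum_card_filter_forall_eq_zero m (Finset.univ : Finset V)
    (fun v => ({v} : Finset V)) 1 fun v _ => Finset.card_singleton v
  -- By `hd` a crossing involves four distinct vertices, so it survives with probability `1 / m ^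
  -- 4`, against `1 / m ^ 2` for an edge and `1 / m` for a vertex.
  have hC := sum_card_filter_forall_eq_zero m (S.crossings E)
    (fun p => ({L p.1, R p.1, L p.2, R p.2} : Finset V)) 4 (by
      rintro ⟨i, j⟩ hij
      obtain ⟨hne, hc⟩ := crosses_of_mem_crossings hij
      obtain ⟨h1, h2, h3, h4⟩ := hd i j hne hc
      rw [Finset.card_insert_of_notMem, Finset.card_insert_of_notMem, Finset.card_pair (hLR j)]
      · simp [L, R, h3, h4]
      · have := hLR i
        simp [L, R, h1, h2] at this ⊢
        exact this)
  have key : ∀ f : V → Fin m,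
      (E.filter fun i => ∀ v ∈ ({L i, R i} : Finset V), f v = 0).card ≤
      3 * ((Finset.univ : Finset V).filter fun v => ∀ w ∈ ({v} : Finset V), f w = 0).card +
      ((S.crossings E).filter fun p =>
        ∀ v ∈ ({L p.1, R p.1, L p.2, R p.2} : Finset V), f v = 0).card := by
    intro f
    set E' := E.filter fun i => ∀ v ∈ ({L i, R i} : Finset V), f v = 0 with hE'
    set W := (Finset.univ : Finset V).filter fun v => ∀ w ∈ ({v} : Finset V), f w = 0 with hW
    have h := card_le_add_crossings (S := S) (V := W.map (Function.Embedding.subtype _)) (E := E')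
      (by
        intro i hi
        have := (Finset.mem_filter.1 hi).2 (L i) (by simp)
        refine Finset.mem_map.2 ⟨L i, ?_, rfl⟩
        simpa [W] using this)
      (by
        intro i hi
        have := (Finset.mem_filter.1 hi).2 (R i) (by simp)
        refine Finset.mem_map.2 ⟨R i, ?_, rfl⟩
        simpa [W] using this)
      (by
        intro i w hw
        obtain ⟨v, -, rfl⟩ := Finset.mem_map.1 hw
        exact hV i v.1 v.2)
    rw [Finset.card_map] at h
    refine h.trans (Nat.add_le_add_left (Finset.card_le_card ?_) _)
    rintro ⟨i, j⟩ hij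
    simp only [crossings, Finset.mem_filter, Finset.mem_product, E'] at hij ⊢
    simp only [Finset.mem_insert, Finset.mem_singleton] at hij ⊢
    refine ⟨⟨⟨hij.1.1.1, hij.1.2.1⟩, hij.2⟩, ?_⟩
    rintro v (rfl | rfl | rfl | rfl)
    · exact hij.1.1.2 _ (.inl rfl)
    · exact hij.1.1.2 _ (.inr rfl)
    · exact hij.1.2.2 _ (.inl rfl)
    · exact hij.1.2.2 _ (.inr rfl)
  have hsum := Finset.sum_le_sum fun f (_ : f ∈ Finset.univ) => key f
  rw [Finset.sum_add_distrib, ← Finset.mul_sum] at hsum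
  rw [Finset.card_univ, Fintype.card_coe] at hVs
  rw [Fintype.card_coe] at hE hC
  have hM : 0 < m ^ V.card := pow_pos (Nat.pos_of_ne_zero hm) _
  refine Nat.le_of_mul_le_mul_right (c := m ^ V.card) ?_ hM
  have h4 := Nat.mul_le_mul_right (m ^ 4) hsum
  calc m ^ 2 * E.card * m ^ V.card = m ^ 2 * (E.card * m ^ V.card) := by ring
    _ = _ * m ^ 4 := by rw [← hE]; ring
    _ ≤ _ := h4
    _ = _ := by
      rw [add_mul, add_mul, hC]
      congr 1
      calc _ = 3 * m ^ 3 * (_ * m ^ 1) := by ring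
        _ = _ := by rw [hVs]; ring

end SegmentFamily

/-! ### The Szemerédi–Trotter bound -/

/-- The incidences between points `(x, y)` and lines `y = s x + t`, each line being given as
`(s, t)`. -/
def incidences (P L : Finset (ℝ × ℝ)) : Finset ((ℝ × ℝ) × (ℝ × ℝ)) :=
  (P ×ˢ L).filter fun x => x.1.2 = x.2.1 * x.1.1 + x.2.2

theorem mem_incidences {P L : Finset (ℝ × ℝ)} {p l : ℝ × ℝ} :
    (p, l) ∈ incidences P L ↔ p ∈ P ∧ l ∈ L ∧ p.2 = l.1 * p.1 + l.2 := by
  simp [incidences, and_assoc]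

/-- Join consecutive points of `P` on each line. An incidence labels the edge starting there, except
for the last one on its line, which costs at most `L.card`. Two distinct lines meet at most once, so
there are at most `L.card ^ 2` ordered crossings. -/
theorem sq_mul_card_incidences_le (P L : Finset (ℝ × ℝ)) (m : ℕ) (hm : m ≠ 0) :
    m ^ 2 * (incidences P L).card ≤ 3 * m ^ 3 * P.card + L.card ^ 2 + m ^ 2 * L.card := by
  classical
  let E := (incidences P L).filter fun x => ∃ q ∈ P, q.2 = x.2.1 * q.1 + x.2.2 ∧ x.1.1 < q.1
  have hE : ∀ x ∈ E, x.1 ∈ P ∧ x.2 ∈ L ∧ x.1.2 = x.2.1 * x.1.1 + x.2.2 := fun x hx =>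
    mem_incidences.1 (Finset.mem_filter.1 hx).1
  have hlast : (incidences P L).card ≤ E.card + L.card := by
    rw [← Finset.card_filter_add_card_filter_not
      fun x => ∃ q ∈ P, q.2 = x.2.1 * q.1 + x.2.2 ∧ x.1.1 < q.1]
    refine Nat.add_le_add_left (Finset.card_le_card_of_injOn Prod.snd ?_ ?_) _
    · rintro ⟨p, l⟩ h
      exact (mem_incidences.1 (Finset.mem_filter.1 h).1).2.1
    · rintro ⟨p, l⟩ h ⟨p', l'⟩ h' (rfl : l = l')
      obtain ⟨h1, h2⟩ := Finset.mem_filter.1 h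
      obtain ⟨h1', h2'⟩ := Finset.mem_filter.1 h'
      rw [mem_incidences] at h1 h1'
      push Not at h2 h2'
      have h3 : p.1 = p'.1 := le_antisymm (h2' p h1.1 h1.2.2) (h2 p' h1'.1 h1'.2.2)
      have h4 : p = p' := Prod.ext h3 (by rw [h1.2.2, h1'.2.2, h3])
      rw [h4]
  have hnext : ∀ x : E, ∃ q ∈ P, q.2 = x.1.2.1 * q.1 + x.1.2.2 ∧ x.1.1.1 < q.1 ∧
      ∀ r ∈ P, r.2 = x.1.2.1 * r.1 + x.1.2.2 → x.1.1.1 < r.1 → q.1 ≤ r.1 := by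
    rintro ⟨x, hx⟩
    obtain ⟨q, hq, hqm⟩ := Finset.exists_min_image
      (P.filter fun q => q.2 = x.2.1 * q.1 + x.2.2 ∧ x.1.1 < q.1) Prod.fst (by
        obtain ⟨q, h1, h2⟩ := (Finset.mem_filter.1 hx).2
        exact ⟨q, Finset.mem_filter.2 ⟨h1, h2⟩⟩)
    simp only [Finset.mem_filter] at hq hqm
    exact ⟨q, hq.1, hq.2.1, hq.2.2, fun r h1 h2 h3 => hqm r ⟨h1, h2, h3⟩⟩
  choose next hnP hnl hnlt hnmin using hnext
  let S : SegmentFamily E :=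
    { left := fun x => x.1.1
      right := next
      slope := fun x => x.1.2.1
      icpt := fun x => x.1.2.2
      left_lt_right := hnlt
      left_on := fun x => (hE x.1 x.2).2.2
      right_on := hnl }
  have hsame : ∀ i j : E, i.1.2 = j.1.2 → ∀ x, S.Over i x → S.Over j x → i = j := by
    have aux : ∀ i j : E, i.1.2 = j.1.2 → ∀ x, S.Over i x → S.Over j x →
        ¬ i.1.1.1 < j.1.1.1 := by
      intro i j hij x hi hj hlt
      have h2 := hnmin i j.1.1 (hE j.1 j.2).1 (hij ▸ (hE j.1 j.2).2.2) hlt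
      exact absurd (hj.1.trans hi.2) (not_lt.2 h2)
    intro i j hij x hi hj
    have h1 : i.1.1.1 = j.1.1.1 :=
      le_antisymm (not_lt.1 (aux j i hij.symm x hj hi)) (not_lt.1 (aux i j hij x hi hj))
    refine Subtype.ext (Prod.ext (Prod.ext h1 ?_) hij)
    rw [(hE i.1 i.2).2.2, (hE j.1 j.2).2.2, h1, hij]
  have huniq : ∀ i j : E, i.1.2 ≠ j.1.2 → ∀ x y, S.height i x = S.height j x →
      S.height i y = S.height j y → x = y := by
    intro i j hij x y hx hy
    simp only [SegmentFamily.height, S] at hx hy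
    by_contra hne
    have h1 : (i.1.2.1 - j.1.2.1) * (x - y) = 0 := by linear_combination hx - hy
    have h2 : i.1.2.1 = j.1.2.1 := by
      rcases mul_eq_zero.1 h1 with h | h
      · linarith
      · exact absurd (sub_eq_zero.1 h) hne
    exact hij (Prod.ext h2 (by rw [h2] at hx; linarith))
  have hcr : (S.crossings Finset.univ).card ≤ L.card ^ 2 := by
    rw [sq, ← Finset.card_product]
    refine Finset.card_le_card_of_injOn (fun p => (p.1.1.2, p.2.1.2)) ?_ ?_
    · intro p _
      exact Finset.mem_product.2 ⟨(hE p.1.1 p.1.2).2.1, (hE p.2.1 p.2.2).2.1⟩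
    · intro p h p' h' heq
      obtain ⟨hne, x, hx⟩ := SegmentFamily.crosses_of_mem_crossings h
      obtain ⟨hne', y, hy⟩ := SegmentFamily.crosses_of_mem_crossings h'
      obtain ⟨i, j⟩ := p
      obtain ⟨i', j'⟩ := p'
      simp only [Prod.mk.injEq] at heq hne hx hy
      have hl : i.1.2 ≠ j.1.2 := fun h => hne (hsame i j h x hx.1 hx.2.1)
      have hxy : x = y := huniq i j hl x y hx.2.2 (by
        have := hy.2.2
        simp only [SegmentFamily.height, S] at this ⊢
        rw [heq.1, heq.2]
        exact this)
      subst hxy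
      rw [hsame i i' heq.1 x hx.1 hy.1, hsame j j' heq.2 x hx.2.1 hy.2.1]
  have hmain := SegmentFamily.sq_mul_card_le (S := S) (V := P) (E := Finset.univ)
    (fun i => (hE i.1 i.2).1) hnP
    (by
      rintro i w hw ⟨h1, h2⟩ h3
      exact absurd h2 (not_lt.2 (hnmin i w hw h3 h1)))
    (by
      rintro i j hij ⟨x, hi, hj, hx⟩
      have hl : i.1.2 ≠ j.1.2 := fun h => hij (hsame i j h x hi hj)
      have aux : ∀ p : ℝ × ℝ, p.2 = S.height i p.1 → p.2 = S.height j p.1 → p.1 = x :=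
        fun p h1 h2 => huniq i j hl _ _ (h1.symm.trans h2) hx
      refine ⟨fun h => ?_, fun h => ?_, fun h => ?_, fun h => ?_⟩
      · exact hi.1.ne (aux _ (S.left_on i) (h ▸ S.left_on j))
      · exact hi.1.ne (aux _ (S.left_on i) (h ▸ S.right_on j))
      · exact hi.2.ne' (aux _ (S.right_on i) (h ▸ S.left_on j))
      · exact hi.2.ne' (aux _ (S.right_on i) (h ▸ S.right_on j))) m hm
  rw [Finset.card_univ, Fintype.card_coe] at hmain
  have h1 := Nat.mul_le_mul_left (m ^ 2) hlast
  rw [mul_add] at h1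
  omega

/-- The Szemerédi–Trotter bound for `n` points and `n` lines. -/
theorem card_incidences_le (P L : Finset (ℝ × ℝ)) (n : ℕ) (hP : P.card ≤ n) (hL : L.card ≤ n) :
    ((incidences P L).card : ℝ) ≤ 8 * (n : ℝ) ^ ((4 : ℝ) / 3) := by
  rcases Nat.eq_zero_or_pos n with rfl | hn
  · have : P = ∅ := Finset.card_eq_zero.1 (by omega)
    subst this
    simp [incidences]
  have hn1 : (1 : ℝ) ≤ n := by exact_mod_cast hn
  set r : ℝ := (n : ℝ) ^ ((1 : ℝ) / 3) with hr
  have hr1 : 1 ≤ r := Real.one_le_rpow hn1 (by norm_num)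
  have hr3 : r ^ 3 = n := by
    rw [hr, ← Real.rpow_natCast, ← Real.rpow_mul (by positivity)]; norm_num
  have hr4 : (n : ℝ) ^ ((4 : ℝ) / 3) = r ^ 4 := by
    rw [hr, ← Real.rpow_natCast, ← Real.rpow_mul (by positivity)]; norm_num
  set m := ⌈r⌉₊ with hm
  have hm1 : r ≤ m := Nat.le_ceil r
  have hm2 : (m : ℝ) ≤ 2 * r := by have := Nat.ceil_lt_add_one (by linarith : 0 ≤ r); linarith
  have hm0 : m ≠ 0 := by rintro h; rw [h] at hm1; norm_num at hm1; linarith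
  have h := sq_mul_card_incidences_le P L m hm0
  have h' : ((m : ℝ) ^ 2) * (incidences P L).card ≤ 3 * m ^ 3 * P.card + L.card ^ 2 +
    m ^ 2 * L.card := by exact_mod_cast h
  have hP' : (P.card : ℝ) ≤ r ^ 3 := by rw [hr3]; exact_mod_cast hP
  have hL' : (L.card : ℝ) ≤ r ^ 3 := by rw [hr3]; exact_mod_cast hL
  have hmp : (0 : ℝ) < m ^ 2 := by positivity
  rw [hr4]
  refine le_of_mul_le_mul_left ?_ hmp
  have b1 : 3 * (m : ℝ) ^ 3 * P.card ≤ m ^ 2 * (6 * r ^ 4) := by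
    calc 3 * (m : ℝ) ^ 3 * P.card ≤ 3 * (m : ℝ) ^ 3 * r ^ 3 := by gcongr
      _ = m ^ 2 * (3 * m * r ^ 3) := by ring
      _ ≤ m ^ 2 * (3 * (2 * r) * r ^ 3) := by gcongr
      _ = _ := by ring
  have b2 : (L.card : ℝ) ^ 2 ≤ m ^ 2 * r ^ 4 := by
    calc (L.card : ℝ) ^ 2 ≤ (r ^ 3) ^ 2 := by gcongr
      _ = r ^ 2 * r ^ 4 := by ring
      _ ≤ _ := by gcongr
  have b3 : (m : ℝ) ^ 2 * L.card ≤ m ^ 2 * r ^ 4 := by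
    have : r ^ 3 ≤ r ^ 4 := pow_le_pow_right₀ hr1 (by norm_num)
    gcongr
    linarith
  linarith

/-! ### Areas of triangles -/

namespace UnitAreaTriangles

theorem volume_standardTriangle :
    volume {p : ℝ × ℝ | 0 ≤ p.1 ∧ 0 ≤ p.2 ∧ p.1 + p.2 ≤ 1} = ENNReal.ofReal (1 / 2) := by
  have hm : MeasurableSet {p : ℝ × ℝ | 0 ≤ p.1 ∧ 0 ≤ p.2 ∧ p.1 + p.2 ≤ 1} :=
    (measurableSet_le measurable_const measurable_fst).inter
      ((measurableSet_le measurable_const measurable_snd).inter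
        (measurableSet_le (measurable_fst.add measurable_snd) measurable_const))
  rw [Measure.volume_eq_prod, Measure.prod_apply hm]
  have h : ∀ x : ℝ, volume (Prod.mk x ⁻¹' {p : ℝ × ℝ | 0 ≤ p.1 ∧ 0 ≤ p.2 ∧ p.1 + p.2 ≤ 1}) =
      (Set.Icc (0 : ℝ) 1).indicator (fun x => ENNReal.ofReal (1 - x)) x := by
    intro x
    by_cases hx : x ∈ Set.Icc (0 : ℝ) 1
    · rw [Set.indicator_of_mem hx]
      have : Prod.mk x ⁻¹' {p : ℝ × ℝ | 0 ≤ p.1 ∧ 0 ≤ p.2 ∧ p.1 + p.2 ≤ 1} =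
          Set.Icc 0 (1 - x) := by
        ext y
        simp only [Set.mem_preimage, Set.mem_ofPred_eq, Set.mem_Icc, hx.1, true_and]
        rw [le_sub_iff_add_le']
      rw [this, Real.volume_Icc, sub_zero]
    · rw [Set.indicator_of_notMem hx]
      convert! measure_empty (μ := (volume : Measure ℝ))
      ext y
      simp only [Set.mem_preimage, Set.mem_ofPred_eq, Set.mem_empty_iff_false, iff_false]
      rintro ⟨h1, h2, h3⟩
      exact hx ⟨h1, by linarith⟩
  rw [lintegral_congr h, lintegral_indicator measurableSet_Icc,
    ← ofReal_integral_eq_lintegral_ofReal]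
  · congr 1
    rw [integral_Icc_eq_integral_Ioc, ← intervalIntegral.integral_of_le zero_le_one]
    rw [intervalIntegral.integral_sub (by simp) (by simp)]
    simp
    norm_num
  · exact (continuous_const.sub continuous_id).integrableOn_Icc
  · filter_upwards [ae_restrict_mem measurableSet_Icc] with x hx
    simpa using hx.2

theorem volume_convexHull_triangle (p : Fin 3 → Plane) :
    volume (convexHull ℝ (Set.range p)) =
      ENNReal.ofReal (|(p 1 0 - p 0 0) * (p 2 1 - p 0 1) - (p 2 0 - p 0 0) * (p 1 1 - p 0 1)| / 2) := by
  let D : Set Plane := {v | 0 ≤ v 0 ∧ 0 ≤ v 1 ∧ v 0 + v 1 ≤ 1}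
  have hDc : Convex ℝ D := by
    intro x hx y hy a b ha hb hab
    obtain ⟨hx0, hx1, hx2⟩ := hx
    obtain ⟨hy0, hy1, hy2⟩ := hy
    refine ⟨?_, ?_, ?_⟩ <;> simp only [PiLp.add_apply, PiLp.smul_apply, smul_eq_mul]
    · positivity
    · positivity
    · nlinarith
  have hD : volume D = ENNReal.ofReal (1 / 2) := by
    have h1 := (volume_preserving_finTwoArrow ℝ).comp (PiLp.volume_preserving_ofLp (Fin 2))
    rw [← volume_standardTriangle, ← h1.measure_preimage]
    · rfl
    · exact ((measurableSet_le measurable_const measurable_fst).inter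
        ((measurableSet_le measurable_const measurable_snd).inter
        (measurableSet_le (measurable_fst.add measurable_snd)
          measurable_const))).nullMeasurableSet
  let A : Plane →ₗ[ℝ] Plane :=
    { toFun := fun v => v 0 • (p 1 - p 0) + v 1 • (p 2 - p 0)
      map_add' := fun v w => by simp only [PiLp.add_apply]; module
      map_smul' := fun c v => by
        simp only [PiLp.smul_apply, smul_eq_mul, RingHom.id_apply]; module }
  have hA : ∀ v, A v = v 0 • (p 1 - p 0) + v 1 • (p 2 - p 0) := fun _ => rfl
  have hdet : LinearMap.det A =
      (p 1 0 - p 0 0) * (p 2 1 - p 0 1) - (p 2 0 - p 0 0) * (p 1 1 - p 0 1) := by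
    rw [← LinearMap.det_toMatrix (EuclideanSpace.basisFun (Fin 2) ℝ).toBasis, Matrix.det_fin_two]
    simp [LinearMap.toMatrix_apply, hA]
  have hull : convexHull ℝ (Set.range p) = (fun x => p 0 + x) '' (A '' D) := by
    apply Set.Subset.antisymm
    · refine convexHull_min ?_ ((hDc.linear_image A).translate _)
      rintro _ ⟨i, rfl⟩
      rw [Set.image_image]
      fin_cases i
      · exact ⟨0, by simp [D], by simp⟩
      · exact ⟨!₂[1, 0], by simp [D], by simp [hA]⟩
      · exact ⟨!₂[0, 1], by simp [D], by simp [hA]⟩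
    · rw [Set.image_image]
      rintro _ ⟨v, ⟨h0, h1, h2⟩, rfl⟩
      have := (convex_convexHull ℝ (Set.range p)).sum_mem (t := Finset.univ)
        (w := ![1 - v 0 - v 1, v 0, v 1]) (z := p) (by
          intro i _
          fin_cases i
          · change 0 ≤ 1 - v 0 - v 1
            linarith
          · exact h0
          · exact h1) (by
          simp [Fin.sum_univ_three]
          ring)
        (fun i _ => subset_convexHull _ _ ⟨i, rfl⟩)
      convert! this using 1
      simp only [Fin.sum_univ_three, hA, Matrix.cons_val]
      module
  rw [hull, Set.image_add_left, measure_preimage_add, Measure.addHaar_image_linearMap, hD, hdet,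
    ← ENNReal.ofReal_mul (abs_nonneg _)]
  congr 1
  ring

/-! ### Coordinates adapted to `ℓ` -/

/-- A positively oriented orthonormal coordinate system of the plane, with origin `(x₀, y₀)` and first
basis vector `(α, β)`. -/
structure Frame where
  x₀ : ℝ
  y₀ : ℝ
  α : ℝ
  β : ℝ
  norm_eq : α ^ 2 + β ^ 2 = 1

namespace Frame

variable (F : Frame)

/-- The first coordinate in the frame. -/
def X (p : Plane) : ℝ := F.α * (p 0 - F.x₀) + F.β * (p 1 - F.y₀)

/-- The second coordinate in the frame. -/
def Y (p : Plane) : ℝ := F.α * (p 1 - F.y₀) - F.β * (p 0 - F.x₀)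

/-- The point with given coordinates in the frame. -/
def point (x y : ℝ) : Plane := !₂[F.x₀ + F.α * x - F.β * y, F.y₀ + F.β * x + F.α * y]

@[simp]
theorem X_point (x y : ℝ) : F.X (F.point x y) = x := by
  simp only [X, point, PiLp.toLp_apply, Matrix.cons_val]
  linear_combination x * F.norm_eq

@[simp]
theorem Y_point (x y : ℝ) : F.Y (F.point x y) = y := by
  simp only [Y, point, PiLp.toLp_apply, Matrix.cons_val]
  linear_combination y * F.norm_eq

theorem ext_coords {p q : Plane} (hX : F.X p = F.X q) (hY : F.Y p = F.Y q) : p = q := by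
  simp only [X, Y] at hX hY
  ext i
  fin_cases i
  · change p 0 = q 0
    linear_combination F.α * hX - F.β * hY - (p 0 - q 0) * F.norm_eq
  · change p 1 = q 1
    linear_combination F.β * hX + F.α * hY - (p 1 - q 1) * F.norm_eq

theorem X_lineMap (p q : Plane) (t : ℝ) :
    F.X (AffineMap.lineMap p q t) = F.X p + t * (F.X q - F.X p) := by
  simp only [X, AffineMap.lineMap_apply, vsub_eq_sub, vadd_eq_add, PiLp.add_apply,
    PiLp.smul_apply, PiLp.sub_apply, smul_eq_mul]
  ring

theorem Y_lineMap (p q : Plane) (t : ℝ) :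
    F.Y (AffineMap.lineMap p q t) = F.Y p + t * (F.Y q - F.Y p) := by
  simp only [Y, AffineMap.lineMap_apply, vsub_eq_sub, vadd_eq_add, PiLp.add_apply,
    PiLp.smul_apply, PiLp.sub_apply, smul_eq_mul]
  ring

theorem volume_triangle (p : Fin 3 → Plane) :
    volume (convexHull ℝ (Set.range p)) = ENNReal.ofReal
      (|(F.X (p 1) - F.X (p 0)) * (F.Y (p 2) - F.Y (p 0)) -
        (F.X (p 2) - F.X (p 0)) * (F.Y (p 1) - F.Y (p 0))| / 2) := by
  rw [volume_convexHull_triangle]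
  congr 3
  simp only [X, Y]
  linear_combination (-(p 1 0 - p 0 0) * (p 2 1 - p 0 1) + (p 2 0 - p 0 0) * (p 1 1 - p 0 1)) *
    F.norm_eq

/-- The line `X = a + m Y`, where `c = (a, m)`. -/
def lineOf (c : ℝ × ℝ) : AffineSubspace ℝ Plane :=
  line[ℝ, F.point c.1 0, F.point (c.1 + c.2) 1]

theorem mem_line_iff {p q r : Plane} (h : F.Y p ≠ F.Y q) : r ∈ line[ℝ, p, q] ↔
    (F.X r - F.X p) * (F.Y q - F.Y p) = (F.Y r - F.Y p) * (F.X q - F.X p) := by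
  have h' : F.Y q - F.Y p ≠ 0 := sub_ne_zero.2 h.symm
  rw [mem_affineSpan_pair_iff_exists_lineMap_eq]
  constructor
  · rintro ⟨t, rfl⟩
    rw [X_lineMap, Y_lineMap]
    ring
  · intro hr
    refine ⟨(F.Y r - F.Y p) / (F.Y q - F.Y p), F.ext_coords ?_ ?_⟩
    · rw [X_lineMap, div_mul_eq_mul_div, ← hr]
      field_simp
      ring
    · rw [Y_lineMap]
      field_simp
      ring

theorem mem_lineOf {c : ℝ × ℝ} {r : Plane} : r ∈ F.lineOf c ↔ F.X r = c.1 + c.2 * F.Y r := by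
  rw [lineOf, F.mem_line_iff (by simp)]
  simp only [X_point, Y_point]
  constructor <;> intro h <;> linarith

theorem lineOf_injective : Function.Injective F.lineOf := by
  intro c d h
  have h1 : F.point c.1 0 ∈ F.lineOf d := by rw [← h, mem_lineOf]; simp
  have h2 : F.point (c.1 + c.2) 1 ∈ F.lineOf d := by rw [← h, mem_lineOf]; simp
  rw [mem_lineOf] at h1 h2
  simp only [X_point, Y_point] at h1 h2
  exact Prod.ext (by linarith) (by linarith)

theorem line_eq_lineOf {c : ℝ × ℝ} {p q : Plane} (h : F.Y p ≠ F.Y q)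
    (hp : F.X p = c.1 + c.2 * F.Y p) (hq : F.X q = c.1 + c.2 * F.Y q) :
    line[ℝ, p, q] = F.lineOf c := by
  have h' : F.Y q - F.Y p ≠ 0 := sub_ne_zero.2 h.symm
  ext r
  rw [F.mem_line_iff h, mem_lineOf, hp, hq]
  constructor
  · intro hr
    refine mul_right_cancel₀ h' ?_
    linear_combination hr
  · intro hr
    rw [hr]
    ring

theorem isLine_lineOf (c : ℝ × ℝ) : IsLine (F.lineOf c) := by
  rw [IsLine, lineOf, direction_affineSpan, vectorSpan_pair]
  refine finrank_span_singleton fun h => ?_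
  have h1 := congrArg F.Y (vsub_eq_zero_iff_eq.1 h)
  simp at h1

variable {F}

/-- The base on `ℓ` has length `|p.1 - q.1|`, and the two lines meet at height `|p.1 - q.1| / |p.2 -
q.2|`. -/
theorem formUnitTriangle_iff {ℓ : AffineSubspace ℝ Plane} (hℓ : ∀ p, p ∈ ℓ ↔ F.Y p = 0)
    {b c : AffineSubspace ℝ Plane} : FormUnitTriangle ℓ b c ↔
      ∃ p q : ℝ × ℝ, b = F.lineOf p ∧ c = F.lineOf q ∧ p.1 ≠ q.1 ∧
        2 * |p.2 - q.2| = (p.1 - q.1) ^ 2 := by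
  constructor
  · rintro ⟨T, ⟨ha, hb, hc⟩, hv⟩
    rw [F.volume_triangle, ENNReal.ofReal_eq_one] at hv
    have h0 : F.Y (T.points 0) = 0 := by
      rw [← hℓ, ha]; exact left_mem_affineSpan_pair _ _ _
    have h1 : F.Y (T.points 1) = 0 := by
      rw [← hℓ, ha]; exact right_mem_affineSpan_pair _ _ _
    set x := F.X (T.points 0)
    set x' := F.X (T.points 1)
    set z := F.X (T.points 2)
    set y := F.Y (T.points 2) with hy
    rw [h0, h1, sub_zero, sub_zero, mul_zero, sub_zero, abs_mul] at hv
    have hy0 : y ≠ 0 := by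
      intro h
      rw [h] at hv
      norm_num at hv
    have hx : x ≠ x' := by
      intro h
      rw [h] at hv
      norm_num at hv
    refine ⟨(x, (z - x) / y), (x', (z - x') / y), ?_, ?_, hx, ?_⟩
    · rw [hb]
      refine F.line_eq_lineOf ?_ ?_ ?_
      · rw [h0, ← hy]; exact hy0.symm
      · simp [h0, x]
      · change z = x + (z - x) / y * y
        field_simp
        ring
    · rw [hc]
      refine F.line_eq_lineOf ?_ ?_ ?_
      · rw [h1, ← hy]; exact hy0.symm
      · simp [h1, x']
      · change z = x' + (z - x') / y * y
        field_simp
        ring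
    · have h3 : (z - x) / y - (z - x') / y = (x' - x) / y := by ring
      change 2 * |(z - x) / y - (z - x') / y| = (x - x') ^ 2
      have h4 : |x' - x| * |y| = 2 := by linarith
      have h5 : |y| ≠ 0 := abs_ne_zero.2 hy0
      rw [h3, abs_div, sub_sq_comm, ← sq_abs (x' - x), ← h4]
      field_simp
  · rintro ⟨p, q, rfl, rfl, hne, h⟩
    have hpq : p.1 - q.1 ≠ 0 := sub_ne_zero.2 hne
    have hm : p.2 - q.2 ≠ 0 := by
      intro h0
      rw [h0, abs_zero, mul_zero] at h
      exact hpq (pow_eq_zero_iff two_ne_zero |>.1 h.symm)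
    set y := (q.1 - p.1) / (p.2 - q.2) with hy
    have hym : y * (p.2 - q.2) = q.1 - p.1 := by rw [hy]; field_simp
    have hy0 : y ≠ 0 := by
      intro h0
      rw [h0, zero_mul] at hym
      exact hpq (by linarith)
    have hz : p.1 + p.2 * y = q.1 + q.2 * y := by linarith
    have hind : AffineIndependent ℝ ![F.point p.1 0, F.point q.1 0, F.point (p.1 + p.2 * y) y] := by
      refine affineIndependent_of_ne_of_mem_of_mem_of_notMem (s := ℓ) ?_ ?_ ?_ ?_
      · intro h0
        have := congrArg F.X h0
        simp only [X_point] at this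
        exact hne this
      · simp [hℓ]
      · simp [hℓ]
      · simp [hℓ, hy0]
    refine ⟨⟨_, hind⟩, ⟨?_, ?_, ?_⟩, ?_⟩
    · simp only [Matrix.cons_val]
      ext r
      rw [hℓ, mem_affineSpan_pair_iff_exists_lineMap_eq]
      constructor
      · intro hr
        refine ⟨(F.X r - p.1) / (q.1 - p.1), F.ext_coords ?_ ?_⟩
        · rw [X_lineMap, X_point, X_point]
          have : q.1 - p.1 ≠ 0 := sub_ne_zero.2 hne.symm
          field_simp
          ring
        · rw [Y_lineMap, Y_point, Y_point, hr]
          ring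
      · rintro ⟨t, rfl⟩
        rw [Y_lineMap, Y_point, Y_point]
        ring
    · simp only [Matrix.cons_val]
      exact (F.line_eq_lineOf (by simpa using hy0.symm) (by simp) (by simp)).symm
    · simp only [Matrix.cons_val]
      exact (F.line_eq_lineOf (by simpa using hy0.symm) (by simp) (by simp [hz])).symm
    · rw [F.volume_triangle, ENNReal.ofReal_eq_one]
      simp only [Matrix.cons_val, X_point, Y_point]
      have h1 : |y| * |p.2 - q.2| = |q.1 - p.1| := by rw [← abs_mul, hym]
      have h2 : |q.1 - p.1| ≠ 0 := abs_ne_zero.2 (sub_ne_zero.2 hne.symm)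
      have h3 : |p.2 - q.2| ≠ 0 := abs_ne_zero.2 hm
      rw [sub_zero, sub_zero, mul_zero, sub_zero, abs_mul]
      rw [sub_sq_comm, ← sq_abs] at h
      have h4 : |q.1 - p.1| * |y| * |p.2 - q.2| = 2 * |p.2 - q.2| := by
        rw [mul_assoc, h1, h]; ring
      have h5 := mul_right_cancel₀ h3 h4
      linarith

end Frame

theorem IsLine.exists_frame {ℓ : AffineSubspace ℝ Plane} (h : IsLine ℓ) :
    ∃ F : Frame, ∀ p, p ∈ ℓ ↔ F.Y p = 0 := by
  obtain ⟨⟨v, hv⟩, hv0, hspan⟩ := finrank_eq_one_iff'.1 h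
  have hne : (ℓ : Set Plane).Nonempty := by
    by_contra hne
    rw [Set.not_nonempty_iff_eq_empty, AffineSubspace.coe_eq_bot_iff] at hne
    rw [IsLine, hne, AffineSubspace.direction_bot, finrank_bot] at h
    exact zero_ne_one h
  obtain ⟨o, ho⟩ := hne
  have hv0 : v ≠ 0 := fun h0 => hv0 (Subtype.ext h0)
  have hn : ‖v‖ ≠ 0 := norm_ne_zero_iff.2 hv0
  have hn2 : ‖v‖ ^ 2 = v 0 ^ 2 + v 1 ^ 2 := by
    rw [EuclideanSpace.norm_sq_eq, Fin.sum_univ_two]; simp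
  refine ⟨⟨o 0, o 1, v 0 / ‖v‖, v 1 / ‖v‖, by rw [div_pow, div_pow, ← add_div, ← hn2]; field_simp⟩,
    fun p => ?_⟩
  have hY : v 0 / ‖v‖ * (p 1 - o 1) - v 1 / ‖v‖ * (p 0 - o 0) = 0 ↔
      v 0 * (p 1 - o 1) = v 1 * (p 0 - o 0) := by
    rw [div_mul_eq_mul_div, div_mul_eq_mul_div, ← sub_div, div_eq_zero_iff, sub_eq_zero]
    simp [hn]
  rw [Frame.Y, hY, ← AffineSubspace.vsub_right_mem_direction_iff_mem ho]
  constructor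
  · intro hp
    obtain ⟨c, hc⟩ := hspan ⟨_, hp⟩
    have hc : c • v = p - o := congrArg Subtype.val hc
    have h0 : c * v 0 = p 0 - o 0 := congrArg (fun w : Plane => w 0) hc
    have h1 : c * v 1 = p 1 - o 1 := congrArg (fun w : Plane => w 1) hc
    rw [← h0, ← h1]
    ring
  · intro hp
    -- The coefficient is that of the orthogonal projection of `p - o` onto `v`.
    have hc : p -ᵥ o = ((v 0 * (p 0 - o 0) + v 1 * (p 1 - o 1)) / ‖v‖ ^ 2) • v := by
      ext i
      fin_cases i
      · change p 0 - o 0 = (v 0 * (p 0 - o 0) + v 1 * (p 1 - o 1)) / ‖v‖ ^ 2 * v 0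
        field_simp
        rw [hn2]
        linear_combination -(v 1) * hp
      · change p 1 - o 1 = (v 0 * (p 0 - o 0) + v 1 * (p 1 - o 1)) / ‖v‖ ^ 2 * v 1
        field_simp
        rw [hn2]
        linear_combination (v 0) * hp
    rw [hc]
    exact Submodule.smul_mem _ _ hv

/-! ### Unit triangles as incidences: the two bounds -/

theorem unitTriangleCount_le {F : Frame} {ℓ : AffineSubspace ℝ Plane}
    (hℓ : ∀ p, p ∈ ℓ ↔ F.Y p = 0) (L : Finset (AffineSubspace ℝ Plane)) :
    (unitTriangleCount ℓ L : ℝ) ≤ 8 * (L.card : ℝ) ^ ((4 : ℝ) / 3) := by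
  classical
  -- Lines parallel to `ℓ` are dropped; they form no triangle with it.
  let Q := L.preimage F.lineOf F.lineOf_injective.injOn
  have hQ : Q.card ≤ L.card := Finset.card_le_card_of_injOn F.lineOf
    (fun c hc => Finset.mem_preimage.1 hc) F.lineOf_injective.injOn
  let P' := Q.image fun c => (c.1, c.2 - c.1 ^ 2 / 2)
  let L' := Q.image fun c => (-c.1, c.2 + c.1 ^ 2 / 2)
  have hP' : P'.card ≤ L.card := Finset.card_image_le.trans hQ
  have hL' : L'.card ≤ L.card := Finset.card_image_le.trans hQ
  refine le_trans ?_ (card_incidences_le P' L' L.card hP' hL')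
  rw [Nat.cast_le]
  -- `ψ` undoes the passage to points and lines. Every unit pair is in its image, with the line of
  -- larger `m` playing the point.
  let ψ : (ℝ × ℝ) × (ℝ × ℝ) → Finset (AffineSubspace ℝ Plane) := fun x =>
    {F.lineOf (x.1.1, x.1.2 + x.1.1 ^ 2 / 2), F.lineOf (-x.2.1, x.2.2 - x.2.1 ^ 2 / 2)}
  have hψ : ∀ p q : ℝ × ℝ, F.lineOf p ∈ L → F.lineOf q ∈ L →
      2 * (p.2 - q.2) = (p.1 - q.1) ^ 2 →
      ({F.lineOf p, F.lineOf q} : Finset _) ∈ (incidences P' L').image ψ := by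
    intro p q hp hq h
    refine Finset.mem_image.2
      ⟨((p.1, p.2 - p.1 ^ 2 / 2), (-q.1, q.2 + q.1 ^ 2 / 2)), mem_incidences.2 ⟨?_, ?_, ?_⟩, ?_⟩
    · exact Finset.mem_image.2 ⟨p, Finset.mem_preimage.2 hp, rfl⟩
    · exact Finset.mem_image.2 ⟨q, Finset.mem_preimage.2 hq, rfl⟩
    · simp only
      linear_combination h / 2
    · simp [ψ]
  refine (Finset.card_le_card (t := (incidences P' L').image ψ) ?_).trans Finset.card_image_le
  intro s hs
  obtain ⟨hs, a, b, rfl, hab⟩ := Finset.mem_filter.1 hs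
  have hsub := (Finset.mem_powersetCard.1 hs).1
  obtain ⟨p, q, rfl, rfl, -, h⟩ := (Frame.formUnitTriangle_iff hℓ).1 hab
  have hp := hsub (Finset.mem_insert_self _ _)
  have hq := hsub (Finset.mem_insert_of_mem (Finset.mem_singleton_self _))
  rcases le_total q.2 p.2 with h1 | h1
  · rw [abs_of_nonneg (sub_nonneg.2 h1)] at h
    exact hψ p q hp hq h
  · rw [abs_of_nonpos (sub_nonpos.2 h1)] at h
    rw [Finset.pair_comm]
    exact hψ q p hq hp (by linarith)

theorem pow_four_le_g {F : Frame} {ℓ : AffineSubspace ℝ Plane}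
    (hℓ : ∀ p, p ∈ ℓ ↔ F.Y p = 0) {n k : ℕ} (hk : 3 * k ^ 3 ≤ n) : k ^ 4 ≤ g ℓ n := by
  classical
  -- These are the lines coming from grid points `(i + 1, r)` and from grid lines of slope `s + 1`
  -- and intercept `t`; the unit-area equation becomes `r = (s + 1)(i + 1) + t`. The shifts by one
  -- make first coordinates positive on `A` and negative on `B`.
  let φA : ℕ × ℕ → ℝ × ℝ := fun x => (x.1 + 1, x.2 + ((x.1 : ℝ) + 1) ^ 2 / 2)
  let φB : ℕ × ℕ → ℝ × ℝ := fun x => (-(x.1 + 1), x.2 - ((x.1 : ℝ) + 1) ^ 2 / 2)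
  let A := (Finset.range k ×ˢ Finset.range (2 * k ^ 2)).image φA
  let B := (Finset.range k ×ˢ Finset.range (k ^ 2)).image φB
  have hcard : (A ∪ B).card ≤ n := by
    have h1 : A.card ≤ k * (2 * k ^ 2) :=
      Finset.card_image_le.trans (by rw [Finset.card_product, Finset.card_range, Finset.card_range])
    have h2 : B.card ≤ k * k ^ 2 :=
      Finset.card_image_le.trans (by rw [Finset.card_product, Finset.card_range, Finset.card_range])
    calc _ ≤ A.card + B.card := Finset.card_union_le _ _
      _ ≤ k * (2 * k ^ 2) + k * k ^ 2 := add_le_add h1 h2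
      _ = 3 * k ^ 3 := by ring
      _ ≤ n := hk
  -- Arbitrary further lines bring the total to exactly `n`; they cannot lower the count.
  obtain ⟨Q, hQ, hQn⟩ := Infinite.exists_superset_card_eq (A ∪ B) n hcard
  let L := Q.map ⟨F.lineOf, F.lineOf_injective⟩
  have hL : unitTriangleCount ℓ L ∈ unitTriangleCounts ℓ n := by
    refine ⟨L, ?_, ?_, by rw [Finset.card_map, hQn], rfl⟩
    · intro a ha
      obtain ⟨c, -, rfl⟩ := Finset.mem_map.1 ha
      exact F.isLine_lineOf c
    · intro h
      obtain ⟨c, -, hc⟩ := Finset.mem_map.1 h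
      have h1 : F.point (c.1 + c.2) 1 ∈ F.lineOf c := by simp [Frame.mem_lineOf]
      have h2 : F.lineOf c = ℓ := hc
      rw [h2, hℓ, Frame.Y_point] at h1
      exact one_ne_zero h1
  refine le_trans ?_ ((isGreatest_g ℓ n).2 hL)
  have hcount : (Finset.range k ×ˢ Finset.range k ×ˢ Finset.range (k ^ 2)).card = k ^ 4 := by
    simp only [Finset.card_product, Finset.card_range]; ring
  rw [← hcount]
  let a : ℕ × ℕ × ℕ → ℝ × ℝ := fun x => φA (x.1, (x.2.1 + 1) * (x.1 + 1) + x.2.2)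
  let b : ℕ × ℕ × ℕ → ℝ × ℝ := fun x => φB x.2
  have hab : ∀ x y, a x ≠ b y := by
    intro x y h
    have h1 : (x.1 : ℝ) + 1 = -((y.2.1 : ℝ) + 1) := congrArg Prod.fst h
    have h2 : (0 : ℝ) ≤ x.1 := Nat.cast_nonneg _
    have h3 : (0 : ℝ) ≤ y.2.1 := Nat.cast_nonneg _
    linarith
  refine Finset.card_le_card_of_injOn (fun x => {F.lineOf (a x), F.lineOf (b x)}) ?_ ?_
  · rintro ⟨i, s, t⟩ hx
    simp only [Finset.coe_product, Set.mem_prod, Finset.coe_range, Set.mem_Iio] at hx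
    obtain ⟨hi, hs, ht⟩ := hx
    have haQ : a (i, s, t) ∈ Q := hQ <| Finset.mem_union_left _ <| Finset.mem_image_of_mem _ <| by
      rw [Finset.mem_product, Finset.mem_range, Finset.mem_range]
      refine ⟨hi, ?_⟩
      have : (s + 1) * (i + 1) ≤ k * k := Nat.mul_le_mul hs hi
      rw [sq] at ht ⊢
      simp only
      omega
    have hbQ : b (i, s, t) ∈ Q := hQ <| Finset.mem_union_right _ <| Finset.mem_image_of_mem _ <| by
      rw [Finset.mem_product, Finset.mem_range, Finset.mem_range]
      exact ⟨hs, ht⟩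
    refine Finset.mem_filter.2 ⟨Finset.mem_powersetCard.2 ⟨?_, ?_⟩, _, _, rfl, ?_⟩
    · intro l hl
      rcases Finset.mem_insert.1 hl with rfl | hl
      · exact Finset.mem_map.2 ⟨_, haQ, rfl⟩
      · rw [Finset.mem_singleton.1 hl]
        exact Finset.mem_map.2 ⟨_, hbQ, rfl⟩
    · exact Finset.card_pair fun h => hab _ _ (F.lineOf_injective h)
    · refine (Frame.formUnitTriangle_iff hℓ).2 ⟨_, _, rfl, rfl, ?_, ?_⟩
      · simp only [a, b, φA, φB]
        have : (0 : ℝ) < (i + 1) + (s + 1) := by positivity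
        intro h
        linarith
      · simp only [a, b, φA, φB]
        rw [abs_of_nonneg]
        · push_cast; ring
        · push_cast
          ring_nf
          positivity
  -- The signs tell the two lines of an unordered pair apart; then `a` gives back `i`, and `b` gives
  -- back `s` and `t`.
  · intro x _ y _ h
    change ({F.lineOf (a x), F.lineOf (b x)} : Finset (AffineSubspace ℝ Plane)) =
      {F.lineOf (a y), F.lineOf (b y)} at h
    have h1 : F.lineOf (a x) = F.lineOf (a y) := by
      have : F.lineOf (a x) ∈ ({F.lineOf (a y), F.lineOf (b y)} : Finset _) := by
        rw [← h]; simp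
      rcases Finset.mem_insert.1 this with h | h
      · exact h
      · exact absurd (F.lineOf_injective (Finset.mem_singleton.1 h)) (hab _ _)
    have h2 : F.lineOf (b x) = F.lineOf (b y) := by
      have : F.lineOf (b x) ∈ ({F.lineOf (a y), F.lineOf (b y)} : Finset _) := by
        rw [← h]; simp
      rcases Finset.mem_insert.1 this with h | h
      · exact absurd (F.lineOf_injective h).symm (hab _ _)
      · exact Finset.mem_singleton.1 h
    replace h1 := congrArg Prod.fst (F.lineOf_injective h1)
    replace h2 := F.lineOf_injective h2
    obtain ⟨i, s, t⟩ := x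
    obtain ⟨i', s', t'⟩ := y
    simp only [a, b, φA, φB, Prod.mk.injEq, add_left_inj, neg_inj, Nat.cast_inj] at h1 h2
    obtain ⟨h2, h3⟩ := h2
    subst h1 h2
    rw [sub_left_inj, Nat.cast_inj] at h3
    rw [h3]

end UnitAreaTriangles

end

theorem mainTheorem2 :
    ∃ c C : ℝ, 0 < c ∧ 0 < C ∧ ∃ N : ℕ,
      ∀ ℓ : AffineSubspace ℝ UnitAreaTriangles.Plane, UnitAreaTriangles.IsLine ℓ →
        ∀ n : ℕ, N ≤ n →
          c * (n : ℝ) ^ ((4 : ℝ) / 3) ≤ (UnitAreaTriangles.g ℓ n : ℝ) ∧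
          (UnitAreaTriangles.g ℓ n : ℝ) ≤ C * (n : ℝ) ^ ((4 : ℝ) / 3) := by
  -- `576 = 24²` is a crude bound for `24^{4/3}`, where `n ≤ 24 k³` for the largest `k` with `3 k³ ≤
  -- n`; `n ≥ 3` ensures `k ≥ 1`.
  refine ⟨1 / 576, 8, by norm_num, by norm_num, 3, fun ℓ hℓ n hn => ?_⟩
  obtain ⟨F, hF⟩ := hℓ.exists_frame
  constructor
  · obtain ⟨k, hk1, hk2, hk3⟩ : ∃ k : ℕ, 1 ≤ k ∧ 3 * k ^ 3 ≤ n ∧ n ≤ 3 * (k + 1) ^ 3 := by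
      have hex : ∃ k : ℕ, n < 3 * (k + 1) ^ 3 := by
        refine ⟨n, ?_⟩
        have : n + 1 ≤ (n + 1) ^ 3 := Nat.le_self_pow (by norm_num) _
        omega
      have h1 : 1 ≤ Nat.find hex := by
        by_contra! h
        have := Nat.find_spec hex
        rw [Nat.lt_one_iff.1 h] at this
        omega
      refine ⟨Nat.find hex, h1, ?_, (Nat.find_spec hex).le⟩
      have := Nat.find_min hex (Nat.sub_lt h1 one_pos)
      rw [Nat.sub_add_cancel h1] at this
      exact not_lt.1 this
    have hk4 : n ≤ 24 * k ^ 3 :=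
      calc n ≤ 3 * (k + 1) ^ 3 := hk3
        _ ≤ 3 * (k + k) ^ 3 := by gcongr
        _ = 24 * k ^ 3 := by ring
    have hk5 : (n : ℝ) ≤ 24 * (k : ℝ) ^ 3 := by exact_mod_cast hk4
    have h1 : (n : ℝ) ^ ((4 : ℝ) / 3) ≤ 576 * (k : ℝ) ^ 4 :=
      calc (n : ℝ) ^ ((4 : ℝ) / 3) ≤ (24 * (k : ℝ) ^ 3) ^ ((4 : ℝ) / 3) := by gcongr
        _ = 24 ^ ((4 : ℝ) / 3) * (k : ℝ) ^ 4 := by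
          rw [Real.mul_rpow (by norm_num) (by positivity), ← Real.rpow_natCast,
            ← Real.rpow_natCast, ← Real.rpow_mul (by positivity)]
          norm_num
        _ ≤ 24 ^ (2 : ℝ) * (k : ℝ) ^ 4 := by
          gcongr
          · norm_num
          · norm_num
        _ = 576 * (k : ℝ) ^ 4 := by norm_num
    have h2 : ((k : ℝ)) ^ 4 ≤ UnitAreaTriangles.g ℓ n := by
      exact_mod_cast UnitAreaTriangles.pow_four_le_g hF hk2
    linarith
  · obtain ⟨L, -, -, hn, hg⟩ := (UnitAreaTriangles.isGreatest_g ℓ n).1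
    rw [← hg, ← hn]
    exact UnitAreaTriangles.unitTriangleCount_le hF L
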